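/- Let $L(s)=p(s)/q(s)$ be a rational function with real coefficients, where $q$ is monic of degree $n$, $\deg p<n$, $p$ and $q$ are coprime, $L(0)=1$, and exactly one of the complex poles of $L$ has maximal real part. (The Laplace–Stieltjes transform of a continuous-time phase-type distribution of algebraic degree $n$, without atom at $0$, is of this form.) Let the distinct roots of $q$ be the real numbers $\lambda_1,\dots,\lambda_\ell$ and the conjugate pairs $\mu_j\pm\imath\omega_j$ ($\ell+1\le j\le k$, $\omega_j\ne 0$), with multiplicities $n_1,\dots,n_k$. Put $$\mathcal J=\mathrm{diag}\big(\mathcal J_{n_1}(\lambda_1),\dots,\mathcal J_{n_\ell}(\lambda_\ell),\mathcal J_{n_{\ell+1}}(\mu_{\ell+1},\omega_{\ell+1}),\dots,\mathcal J_{n_k}(\mu_k,\omega_k)\big)\in\mathbb R^{n\times n},$$ where $\mathcal J_m(\lambda)$ is the $m\times m$ matrix with $\lambda$ on the diagonal and $1$ on the first subdiagonal, and $\mathcal J_m(\mu,\omega)$ is the $2m\times 2m$ matrix with $2\times2$ blocks $\begin{bmatrix}\mu&-\omega\\ \omega&\mu\end{bmatrix}$ on the block diagonal and $2\times 2$ identity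 blocks on the first block subdiagonal. Let $$\xi=-\Big(\sum_{i=1}^{\ell}n_i\lambda_i+\sum_{j=\ell+1}^{k}2n_j\mu_j\Big),$$ let $\mathbf 1$ be the row vector of ones, and let $\beta\in\mathbb R^n$ be the row vector with $L(s)=-\beta\mathcal J(sI-\mathcal J)^{-1}\mathbf 1^\top$ for all $s\in\mathbb C$ with $q(s)\ne0$. Let $\mathcal A$ be the set of all $A=(a_{ij})\in\mathbb R^{n\times n}$ with $A\mathbf 1^\top\le\mathbf 0$, $-\xi\le a_{ii}\le 0$ for all $i$, and $0\le a_{ij}\le\xi$ for all $i\ne j$. For $A\in\mathcal A$ let $\mathrm{Sol}(A)$ be the set of optimal solutions $P\in\mathbb R^{n\times n}$ of $$\min_P\ \|PA-\mathcal JP\|_F^2\quad\text{subject to}\quad P\mathbf 1^\top=\mathbf 1^\top,\ \ \beta P\ge\mathbf 0,$$ where $\|\cdot\|_F$ is the Frobenius norm. Then the sets $\mathrm{Sol}(A)$ are bounded uniformly in $A\in\mathcal A$: there is a constant $M$ (independent of $A$) such that $\|P\|_F\le M$ for every $A\in\mathcal A$ and every $P\in\mathrm{Sol}(A)$. -/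

import Mathlib

open Polynomial
open scoped Matrix
open scoped Matrix.Norms.Frobenius

/-- Standing assumptions on the rational function `L(s) = p(s) / q(s)` with real coefficients:
`q` is monic, `deg p < deg q`, `p` and `q` are coprime, `L(0) = 1`, and among the complex poles
of `L` exactly one has maximal real part. -/
structure IsPHRational (p q : ℝ[X]) : Prop where
  monic : q.Monic
  degree_lt : p.degree < q.degree
  coprime : IsCoprime p q
  eval_zero : p.eval 0 / q.eval 0 = 1
  dominant_pole : ∃! z : ℂ, aeval z q = 0 ∧ ∀ w : ℂ, aeval w q = 0 → w.re ≤ z.re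

/-- An enumeration of the distinct roots of the real monic polynomial `q`: the real roots
`lam i` with multiplicities `multR i`, and the pairs of conjugate non-real roots
`mu j ± i * omega j` with multiplicities `multC j`. -/
structure PoleData (q : ℝ[X]) where
  numR : ℕ
  numC : ℕ
  lam : Fin numR → ℝ
  multR : Fin numR → ℕ
  mu : Fin numC → ℝ
  omega : Fin numC → ℝ
  multC : Fin numC → ℕ
  multR_pos : ∀ i, 0 < multR i
  multC_pos : ∀ j, 0 < multC j
  omega_ne_zero : ∀ j, omega j ≠ 0
  lam_injective : Function.Injective lam
  pair_injective : Function.Injective fun j => (mu j, |omega j|)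
  factorization : q = (∏ i, (X - C (lam i)) ^ multR i) *
    ∏ j, ((X - C (mu j)) ^ 2 + C (omega j) ^ 2) ^ multC j

/-- The `m × m` lower Jordan block with eigenvalue `l`. -/
def jordanR (m : ℕ) (l : ℝ) : Matrix (Fin m) (Fin m) ℝ :=
  Matrix.of fun r c => if r = c then l else if r.val = c.val + 1 then 1 else 0

/-- The `2 × 2` matrix of the conjugate pair `μ ± i ω`. -/
def thetaBlock (μ ω : ℝ) : Matrix (Fin 2) (Fin 2) ℝ :=
  !![μ, -ω; ω, μ]

/-- The `2m × 2m` real lower Jordan block of the conjugate pair `μ ± i ω`: an `m × m` array of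
`2 × 2` blocks, with `thetaBlock μ ω` on the diagonal and the identity on the subdiagonal. -/
def jordanC (m : ℕ) (μ ω : ℝ) : Matrix (Fin m × Fin 2) (Fin m × Fin 2) ℝ :=
  Matrix.of fun x y =>
    if x.1 = y.1 then thetaBlock μ ω x.2 y.2
    else if x.1.val = y.1.val + 1 then (1 : Matrix (Fin 2) (Fin 2) ℝ) x.2 y.2 else 0

namespace PoleData

variable {q : ℝ[X]} (D : PoleData q)

/-- The index set of rows and columns; it has `n = deg q` elements. -/
abbrev Idx : Type :=
  (Σ i : Fin D.numR, Fin (D.multR i)) ⊕ (Σ j : Fin D.numC, Fin (D.multC j) × Fin 2)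

/-- The block diagonal real Jordan matrix with exactly one Jordan block for every real root
and one for every pair of conjugate non-real roots. -/
def jordan : Matrix D.Idx D.Idx ℝ :=
  Matrix.fromBlocks
    (Matrix.blockDiagonal' fun i => jordanR (D.multR i) (D.lam i)) 0
    0 (Matrix.blockDiagonal' fun j => jordanC (D.multC j) (D.mu j) (D.omega j))

/-- Minus the sum of all roots of `q`, counted with multiplicity. -/
def xi : ℝ :=
  -((∑ i, (D.multR i : ℝ) * D.lam i) + ∑ j, 2 * (D.multC j : ℝ) * D.mu j)

/-- `β` is the real row vector solving `p(s) / q(s) = -β J (s I - J)⁻¹ 1ᵀ`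
(an identity of rational functions of `s`), with `J` the Jordan matrix. -/
def IsBeta (p : ℝ[X]) (β : D.Idx → ℝ) : Prop :=
  ∀ s : ℂ, aeval s q ≠ 0 →
    aeval s p / aeval s q =
      -(((fun i => (β i : ℂ)) ᵥ* (D.jordan.map (fun x : ℝ => (x : ℂ)) *
          (s • (1 : Matrix D.Idx D.Idx ℂ) - D.jordan.map (fun x : ℝ => (x : ℂ)))⁻¹)) ⬝ᵥ
        (1 : D.Idx → ℂ))

/-- The objective `‖P A - J P‖_F ^ 2`; the norm is the Frobenius norm. -/
noncomputable def objective (A P : Matrix D.Idx D.Idx ℝ) : ℝ :=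
  ‖P * A - D.jordan * P‖ ^ 2

/-- The constraint set for `A`: nonpositive row sums, diagonal entries in `[-ξ, 0]` and
off-diagonal entries in `[0, ξ]`. -/
def feasibleA : Set (Matrix D.Idx D.Idx ℝ) :=
  {A | A *ᵥ 1 ≤ 0 ∧ (∀ i, -D.xi ≤ A i i ∧ A i i ≤ 0) ∧
    ∀ i j, i ≠ j → 0 ≤ A i j ∧ A i j ≤ D.xi}

/-- The constraint set for `P`: `P 1ᵀ = 1ᵀ` and `β P ≥ 0`. -/
def feasibleP (β : D.Idx → ℝ) : Set (Matrix D.Idx D.Idx ℝ) :=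
  {P | P *ᵥ 1 = 1 ∧ 0 ≤ β ᵥ* P}

/-- The set of optimal solutions `P` of: minimize `‖P A - J P‖_F ^ 2` subject to
`P 1ᵀ = 1ᵀ` and `β P ≥ 0`. -/
def optimalSet (β : D.Idx → ℝ) (A : Matrix D.Idx D.Idx ℝ) : Set (Matrix D.Idx D.Idx ℝ) :=
  {P | P ∈ D.feasibleP β ∧ IsMinOn (D.objective A) (D.feasibleP β) P}

end PoleData

/-! The proof combines compactness with observability of $(\beta,J)$. If $PA=JP$, $P\mathbf 1=0$ and
$\beta P\ge0$, the entries of $\beta P$ sum to $0$, so $\beta P=0$ and $\beta J^kP=\beta PA^k=0$ for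
all $k$; observability forces $P=0$ (`IsBeta.eq_zero_of_recession`). Hence $\|PA-JP\|+\|P\mathbf
1\|$ has a bound $c>0$ from below on pairs with $A$ bounded, $\|P\|=1$, $\beta P\ge0$. By
homogeneity, $c\|P\|\le\|PA-JP\|+\|\mathbf 1\|$ for feasible $P$, and optimality bounds the residual
by that of a fixed feasible matrix. Observability comes from coprimality: $\beta g(J)=0$ makes
$gp/q$ a polynomial, so $q\mid g$. -/

/-- The expression `u (g(s) - g(J)) (s - J)⁻¹ w` is a polynomial in `s`. -/
theorem exists_polynomial_eval_eq_resolvent {K ι : Type*} [Field K] [Fintype ι] [DecidableEq ι]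
    (J : Matrix ι ι K) (u w : ι → K) (g : K[X]) :
    ∃ h : K[X], ∀ s : K, IsUnit (s • (1 : Matrix ι ι K) - J).det →
      (u ᵥ* ((g.eval s • (1 : Matrix ι ι K) - aeval J g) *
        (s • (1 : Matrix ι ι K) - J)⁻¹)) ⬝ᵥ w = h.eval s := by
  induction g using Polynomial.induction_on' with
  | add a b ha hb =>
    obtain ⟨h₁, H₁⟩ := ha
    obtain ⟨h₂, H₂⟩ := hb
    refine ⟨h₁ + h₂, fun s hs => ?_⟩
    rw [eval_add, eval_add, ← H₁ s hs, ← H₂ s hs, ← add_dotProduct, ← Matrix.vecMul_add,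
      ← add_mul, map_add, add_smul]
    congr 3
    abel
  | monomial k a =>
    -- The coefficients come from $s^k-J^k=\sum_{i<k}s^iJ^{k-1-i}\,(s-J)$.
    refine ⟨∑ i ∈ Finset.range k, C (a * ((u ᵥ* J ^ (k - 1 - i)) ⬝ᵥ w)) * X ^ i, fun s hs => ?_⟩
    have hc : Commute (s • (1 : Matrix ι ι K)) J := (Commute.one_left J).smul_left s
    have key : (eval s (monomial k a) • (1 : Matrix ι ι K) - aeval J (monomial k a)) *
        (s • (1 : Matrix ι ι K) - J)⁻¹ =
        ∑ i ∈ Finset.range k, (a * s ^ i) • J ^ (k - 1 - i) := by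
      have : eval s (monomial k a) • (1 : Matrix ι ι K) - aeval J (monomial k a) =
          (∑ i ∈ Finset.range k, (a * s ^ i) • J ^ (k - 1 - i)) *
            (s • (1 : Matrix ι ι K) - J) := by
        have h := hc.geom_sum₂_mul k
        simp only [_root_.smul_pow, one_pow, smul_mul_assoc, one_mul] at h
        simp only [mul_smul, ← Finset.smul_sum, smul_mul_assoc, h]
        rw [eval_monomial, aeval_monomial, Algebra.algebraMap_eq_smul_one, smul_sub, mul_smul,
          smul_mul_assoc, one_mul]
      rw [this, Matrix.mul_nonsing_inv_cancel_right _ _ hs]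
    rw [key, Matrix.vecMul_sum, sum_dotProduct, eval_finsetSum]
    refine Finset.sum_congr rfl fun i _ => ?_
    rw [Matrix.vecMul_smul, smul_dotProduct, eval_mul, eval_C, eval_pow, eval_X, smul_eq_mul]
    ring

/-- If the transfer function `-β J (s - J)⁻¹ w` equals the reduced fraction `p / q`, then no
nonzero polynomial `g` of degree less than `deg q` satisfies `β g(J) = 0`. -/
theorem eq_zero_of_vecMul_aeval_eq_zero {K ι : Type*} [Field K] [Infinite K] [Fintype ι]
    [DecidableEq ι] {p q g : K[X]} (hpq : IsCoprime p q) (hq : q ≠ 0)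
    (J : Matrix ι ι K) (β w : ι → K)
    (hL : ∀ s : K, q.eval s ≠ 0 → p.eval s / q.eval s =
      -((β ᵥ* (J * (s • (1 : Matrix ι ι K) - J)⁻¹)) ⬝ᵥ w))
    (hdeg : g.degree < q.degree) (hg : β ᵥ* aeval J g = 0) : g = 0 := by
  obtain ⟨h, H⟩ := exists_polynomial_eval_eq_resolvent J (-(β ᵥ* J)) w g
  -- The resolvent identity $g\,p/q=h$ is available only off the zeros of $q$ and of the
  -- characteristic polynomial; the extra factor makes the product vanish at every $s$.
  have hgp : (g * p - h * q) * (q * J.charpoly) = 0 := by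
    refine funext fun s => ?_
    rw [eval_zero, eval_mul]
    by_cases hs : (q * J.charpoly).eval s = 0
    · rw [hs, mul_zero]
    rw [eval_mul] at hs
    have hqs := left_ne_zero_of_mul hs
    have hdet : IsUnit (s • (1 : Matrix ι ι K) - J).det := by
      have := right_ne_zero_of_mul hs
      rwa [Matrix.eval_charpoly, Matrix.scalar_apply, ← Matrix.smul_one_eq_diagonal, ← isUnit_iff_ne_zero] at this
    have hcomm : J * aeval J g = aeval J g * J := by
      simpa [commute_iff_eq] using (commute_X g).map (aeval J : K[X] →ₐ[K] Matrix ι ι K)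
    have hJg : (β ᵥ* J) ᵥ* (aeval J g * (s • (1 : Matrix ι ι K) - J)⁻¹) = 0 := by
      rw [← Matrix.vecMul_vecMul, Matrix.vecMul_vecMul β,
        hcomm, ← Matrix.vecMul_vecMul, hg, Matrix.zero_vecMul,
        Matrix.zero_vecMul]
    have e := H s hdet
    rw [Matrix.neg_vecMul, sub_mul, Matrix.vecMul_sub, hJg, sub_zero, smul_mul_assoc, one_mul,
      Matrix.vecMul_smul, Matrix.vecMul_vecMul, ← smul_neg, smul_dotProduct, neg_dotProduct,
      ← hL s hqs, smul_eq_mul] at e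
    rw [eval_sub, eval_mul, eval_mul, ← e]
    field_simp
    simp
  have hgp' : g * p = h * q :=
    sub_eq_zero.1 ((mul_eq_zero.1 hgp).resolve_right
      (mul_ne_zero hq J.charpoly_monic.ne_zero))
  have hdvd : q ∣ g := hpq.symm.dvd_of_dvd_mul_right (hgp' ▸ dvd_mul_left q h)
  exact eq_zero_of_dvd_of_degree_lt hdvd hdeg

/-- If no nonzero polynomial `g` of degree less than the size of `J` satisfies `β g(J) = 0`,
then the pair `(β, J)` is observable. -/
theorem eq_zero_of_forall_vecMul_pow_dotProduct_eq_zero {K ι : Type*} [Field K] [Fintype ι]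
    [DecidableEq ι] (J : Matrix ι ι K) (β : ι → K)
    (hβ : ∀ g : K[X], g.degree < Fintype.card ι → β ᵥ* aeval J g = 0 → g = 0)
    {v : ι → K} (hv : ∀ k : ℕ, (β ᵥ* J ^ k) ⬝ᵥ v = 0) : v = 0 := by
  -- Injectivity and equality of dimensions make every row vector of the form $\beta g(J)$.
  let T : degreeLT K (Fintype.card ι) →ₗ[K] (ι → K) :=
    { toFun := fun g => β ᵥ* aeval J (g : K[X])
      map_add' := fun a b => by simp [Matrix.vecMul_add]
      map_smul' := fun c a => by simp [Matrix.vecMul_smul] }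
  have hinj : Function.Injective T := by
    rw [← LinearMap.ker_eq_bot, LinearMap.ker_eq_bot']
    exact fun g hg => Subtype.ext (hβ g (mem_degreeLT.1 g.2) hg)
  have hfin : Module.finrank K (degreeLT K (Fintype.card ι)) = Module.finrank K (ι → K) := by
    rw [(degreeLTEquiv K (Fintype.card ι)).finrank_eq]
    simp
  have : FiniteDimensional K (degreeLT K (Fintype.card ι)) :=
    (degreeLTEquiv K (Fintype.card ι)).symm.finiteDimensional
  have hsurj : Function.Surjective T :=
    (LinearMap.injective_iff_surjective_of_finrank_eq_finrank hfin).1 hinj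
  have hpoly : ∀ g : K[X], (β ᵥ* aeval J g) ⬝ᵥ v = 0 := by
    intro g
    induction g using Polynomial.induction_on' with
    | add a b ha hb => rw [map_add, Matrix.vecMul_add, add_dotProduct, ha, hb, add_zero]
    | monomial k a =>
      rw [aeval_monomial, ← Algebra.smul_def, Matrix.vecMul_smul, smul_dotProduct, hv, smul_zero]
  refine dotProduct_eq_zero_iff.1 fun u => ?_
  obtain ⟨g, rfl⟩ := hsurj u
  rw [dotProduct_comm]
  exact hpoly g

namespace PoleData

variable {q : ℝ[X]} (D : PoleData q)

theorem card_idx : Fintype.card D.Idx = q.natDegree := by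
  have hR : ∀ i ∈ Finset.univ, ((X - C (D.lam i)) ^ D.multR i).Monic :=
    fun i _ => (monic_X_sub_C _).pow _
  have hlt : ∀ j, (C (D.omega j) ^ 2).degree < ((X - C (D.mu j)) ^ 2).degree := fun j => by
    rw [degree_pow (X - C (D.mu j)), degree_X_sub_C, ← C_pow]
    exact degree_C_le.trans_lt (by norm_num)
  have hC₀ : ∀ j, ((X - C (D.mu j)) ^ 2 + C (D.omega j) ^ 2).Monic := fun j =>
    ((monic_X_sub_C _).pow 2).add_of_left (hlt j)
  have hC : ∀ j ∈ Finset.univ,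
      (((X - C (D.mu j)) ^ 2 + C (D.omega j) ^ 2) ^ D.multC j).Monic :=
    fun j _ => (hC₀ j).pow _
  have hdeg : ∀ j, ((X - C (D.mu j)) ^ 2 + C (D.omega j) ^ 2).natDegree = 2 := fun j => by
    rw [natDegree_add_eq_left_of_degree_lt (hlt j), natDegree_pow, natDegree_X_sub_C]
  conv_rhs => rw [D.factorization]
  rw [(monic_prod_of_monic _ _ hR).natDegree_mul (monic_prod_of_monic _ _ hC),
    natDegree_prod_of_monic _ _ hR, natDegree_prod_of_monic _ _ hC]
  simp [natDegree_pow, hdeg]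

/-- The pair `(β, J)` is observable, since `p / q` is reduced. -/
theorem IsBeta.eq_zero_of_forall_dotProduct_eq_zero {p : ℝ[X]} (hq : q ≠ 0)
    (hpq : IsCoprime p q) {D : PoleData q} {β : D.Idx → ℝ} (hβ : D.IsBeta p β)
    {v : D.Idx → ℝ} (hv : ∀ k : ℕ, (β ᵥ* D.jordan ^ k) ⬝ᵥ v = 0) : v = 0 := by
  refine eq_zero_of_forall_vecMul_pow_dotProduct_eq_zero D.jordan β (fun g hdeg hg => ?_) hv
  rw [D.card_idx, ← degree_eq_natDegree hq] at hdeg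
  -- The identity defining $\beta$ is over $\mathbb C$, so the argument is run there.
  rw [← Polynomial.map_eq_zero (algebraMap ℝ ℂ)]
  refine eq_zero_of_vecMul_aeval_eq_zero (p := p.map (algebraMap ℝ ℂ))
    (q := q.map (algebraMap ℝ ℂ)) (hpq.map (mapRingHom (algebraMap ℝ ℂ)))
    ((Polynomial.map_ne_zero_iff (algebraMap ℝ ℂ).injective).2 hq)
    (D.jordan.map (fun x : ℝ => (x : ℂ))) (fun i => (β i : ℂ)) 1 (fun s hs => ?_) ?_ ?_
  · rw [eval_map_algebraMap] at hs ⊢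
    rw [eval_map_algebraMap]
    exact hβ s hs
  · rwa [degree_map, degree_map]
  · have h₁ : aeval (D.jordan.map (fun x : ℝ => (x : ℂ))) (g.map (algebraMap ℝ ℂ)) =
        (aeval D.jordan g).map (algebraMap ℝ ℂ) := by
      rw [aeval_map_algebraMap]
      exact aeval_algHom_apply (Algebra.ofId ℝ ℂ).mapMatrix D.jordan g
    rw [h₁]
    funext i
    have := RingHom.map_vecMul (algebraMap ℝ ℂ) (aeval D.jordan g) β i
    rw [hg] at this
    exact this.symm.trans (map_zero (algebraMap ℝ ℂ))

/-- The directions along which the feasible set is unbounded and the residual `P A - J P` is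
constant are trivial. -/
theorem IsBeta.eq_zero_of_recession {p : ℝ[X]} (hq : q ≠ 0) (hpq : IsCoprime p q)
    {D : PoleData q} {β : D.Idx → ℝ} (hβ : D.IsBeta p β) {A P : Matrix D.Idx D.Idx ℝ}
    (hAP : P * A = D.jordan * P) (hP1 : P *ᵥ 1 = 0) (hβP : 0 ≤ β ᵥ* P) : P = 0 := by
  have hsum : (β ᵥ* P) ⬝ᵥ 1 = 0 := by
    rw [← Matrix.dotProduct_mulVec, hP1, dotProduct_zero]
  have hβP0 : β ᵥ* P = 0 := by
    rw [dotProduct_one] at hsum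
    funext i
    exact (Finset.sum_eq_zero_iff_of_nonneg fun i _ => hβP i).1 hsum i (Finset.mem_univ i)
  have hpow : ∀ k : ℕ, D.jordan ^ k * P = P * A ^ k := by
    intro k
    induction k with
    | zero => simp
    | succ k ih => rw [pow_succ, mul_assoc, ← hAP, ← mul_assoc, ih, mul_assoc, ← pow_succ]
  ext i j
  refine congrFun (hβ.eq_zero_of_forall_dotProduct_eq_zero hq hpq (v := P.col j)
    fun k => ?_) i
  have : β ᵥ* (D.jordan ^ k * P) = 0 := by
    rw [hpow, ← Matrix.vecMul_vecMul, hβP0, Matrix.zero_vecMul]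
  rw [← Matrix.vecMul_vecMul] at this
  exact congrFun this j

theorem feasibleA_bounded : ∃ R : ℝ, ∀ A ∈ D.feasibleA, ‖A‖ ≤ R := by
  refine ⟨‖(Matrix.of fun _ _ => D.xi : Matrix D.Idx D.Idx ℝ)‖, fun A hA => ?_⟩
  rw [Matrix.frobenius_norm_def, Matrix.frobenius_norm_def]
  gcongr with i _ j _
  rw [Matrix.of_apply, Real.norm_eq_abs, Real.norm_eq_abs]
  refine le_trans (abs_le.2 ?_) (le_abs_self _)
  by_cases hij : i = j
  · subst hij
    have := hA.2.1 i
    constructor <;> linarith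
  · have := hA.2.2 i j hij
    constructor <;> linarith

end PoleData

theorem mainTheorem8 (p q : ℝ[X]) (hL : IsPHRational p q) (D : PoleData q)
    (β : D.Idx → ℝ) (hβ : D.IsBeta p β) :
    ∃ M : ℝ, ∀ A ∈ D.feasibleA, ∀ P ∈ D.optimalSet β A, ‖P‖ ≤ M := by
  obtain ⟨R, hR⟩ := D.feasibleA_bounded
  let φ : Matrix D.Idx D.Idx ℝ × Matrix D.Idx D.Idx ℝ → ℝ :=
    fun x => ‖x.2 * x.1 - D.jordan * x.2‖ + ‖x.2 *ᵥ 1‖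
  let K : Set (Matrix D.Idx D.Idx ℝ × Matrix D.Idx D.Idx ℝ) :=
    (Metric.closedBall 0 R ×ˢ Metric.sphere 0 1) ∩ {x | 0 ≤ β ᵥ* x.2}
  have hK : IsCompact K := by
    refine ((isCompact_closedBall 0 R).prod (isCompact_sphere 0 1)).inter_right ?_
    exact isClosed_le continuous_const (continuous_const.matrix_vecMul continuous_snd)
  have hφ : Continuous φ := by
    refine Continuous.add (by fun_prop) ?_
    exact (continuous_snd.matrix_mulVec continuous_const).norm
  have hpos : ∀ x ∈ K, 0 < φ x := by
    rintro ⟨A, P⟩ ⟨⟨-, hP⟩, hβP⟩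
    refine lt_of_le_of_ne (by positivity) fun h0 => ?_
    have h := (add_eq_zero_iff_of_nonneg (norm_nonneg _) (norm_nonneg _)).1 h0.symm
    have hP0 : P = 0 := hβ.eq_zero_of_recession hL.monic.ne_zero hL.coprime
      (sub_eq_zero.1 (norm_eq_zero.1 h.1)) (norm_eq_zero.1 h.2) hβP
    simp [hP0] at hP
  obtain ⟨c, hc, hcK⟩ := hK.exists_forall_le' hφ.continuousOn hpos
  -- The comparison matrix has all entries $1/n$, so it does not depend on $A$.
  let P₀ : Matrix D.Idx D.Idx ℝ := Matrix.of fun _ _ => (Fintype.card D.Idx : ℝ)⁻¹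
  refine ⟨(‖P₀‖ * R + ‖D.jordan‖ * ‖P₀‖ + ‖(1 : D.Idx → ℝ)‖) / c, fun A hA P hP => ?_⟩
  -- Here $\beta\mathbf 1=\beta P\mathbf 1\ge0$, which is what makes $\beta P_0\ge0$.
  have hβ1 : 0 ≤ ∑ i, β i := by
    rw [← dotProduct_one, ← hP.1.1, Matrix.dotProduct_mulVec, dotProduct_one]
    exact Finset.sum_nonneg fun i _ => hP.1.2 i
  have hP₀ : P₀ ∈ D.feasibleP β := by
    constructor
    · funext i
      have : (Fintype.card D.Idx : ℝ) ≠ 0 := by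
        have : Nonempty D.Idx := ⟨i⟩
        exact_mod_cast Fintype.card_ne_zero
      simp only [P₀, Matrix.mulVec, dotProduct_one, Matrix.of_apply, Finset.sum_const,
        Finset.card_univ, nsmul_eq_mul, Pi.one_apply]
      exact mul_inv_cancel₀ this
    · intro j
      simp only [P₀, Matrix.vecMul, dotProduct, Matrix.of_apply, Pi.zero_apply,
        ← Finset.sum_mul]
      positivity
  have hres : ‖P * A - D.jordan * P‖ ≤ ‖P₀‖ * R + ‖D.jordan‖ * ‖P₀‖ :=
    calc ‖P * A - D.jordan * P‖ ≤ ‖P₀ * A - D.jordan * P₀‖ :=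
          (sq_le_sq₀ (norm_nonneg _) (norm_nonneg _)).1 (hP.2 hP₀)
      _ ≤ ‖P₀ * A‖ + ‖D.jordan * P₀‖ := norm_sub_le _ _
      _ ≤ ‖P₀‖ * ‖A‖ + ‖D.jordan‖ * ‖P₀‖ :=
          add_le_add (Matrix.frobenius_norm_mul _ _) (Matrix.frobenius_norm_mul _ _)
      _ ≤ ‖P₀‖ * R + ‖D.jordan‖ * ‖P₀‖ := by gcongr; exact hR A hA
  rw [le_div_iff₀ hc]
  -- Only a nonzero $P$ can be rescaled to the unit sphere.
  rcases eq_or_ne P 0 with rfl | hP0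
  · rw [norm_zero, zero_mul]
    exact add_nonneg ((norm_nonneg _).trans hres) (norm_nonneg _)
  have hn : 0 < ‖P‖ := norm_pos_iff.2 hP0
  have hmem : (A, ‖P‖⁻¹ • P) ∈ K := by
    refine ⟨⟨mem_closedBall_zero_iff.2 (hR A hA), mem_sphere_zero_iff_norm.2 ?_⟩, ?_⟩
    · rw [norm_smul, norm_inv, norm_norm, inv_mul_cancel₀ hn.ne']
    · change 0 ≤ β ᵥ* (‖P‖⁻¹ • P)
      rw [Matrix.vecMul_smul]
      exact smul_nonneg (by positivity) hP.1.2
  have hval : ‖P‖ * φ (A, ‖P‖⁻¹ • P) = ‖P * A - D.jordan * P‖ + ‖(1 : D.Idx → ℝ)‖ := by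
    simp only [φ]
    rw [smul_mul_assoc, mul_smul_comm, ← smul_sub, Matrix.smul_mulVec, hP.1.1, norm_smul,
      norm_smul, norm_inv, norm_norm, ← mul_add, mul_inv_cancel_left₀ hn.ne']
  calc ‖P‖ * c ≤ ‖P‖ * φ (A, ‖P‖⁻¹ • P) := by gcongr; exact hcK _ hmem
    _ = ‖P * A - D.jordan * P‖ + ‖(1 : D.Idx → ℝ)‖ := hval
    _ ≤ _ := by gcongr
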